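/- Let $G$ be a finite metabelian group, that is, a finite group whose derived subgroup $G'$ is abelian. Then $G$ is an M-group: for every irreducible complex character $\chi$ of $G$ there are a subgroup $H \le G$ (possibly $H = G$) and a linear character $\lambda$ of $H$ (a complex character with $\lambda(1)=1$) such that $\chi = \lambda^G$, where $\lambda^G$ is the induced character $$\lambda^G(g) = \frac{1}{|H|} \sum_{\substack{x \in G \\ xgx^{-1} \in H}} \lambda(xgx^{-1}) \qquad (g \in G).$$ -/

import Mathlib

noncomputable section

/-- A group is metabelian if its derived subgroup is abelian. -/
def IsMetabelianGroup (G : Type*) [Group G] : Prop :=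
  ∀ a ∈ commutator G, ∀ b ∈ commutator G, a * b = b * a

/-- `χ : G → ℂ` is a complex character of `G`: the trace function of a representation of `G` on
some `ℂⁿ` with `n` positive. -/
def IsComplexCharacter {G : Type*} [Group G] (χ : G → ℂ) : Prop :=
  ∃ (n : ℕ) (ρ : Representation ℂ G (Fin n → ℂ)), 0 < n ∧ ρ.character = χ

/-- `χ` belongs to `Irr(G)`: it is the trace function of an irreducible representation of `G` on
some `ℂⁿ` (irreducible representations are nonzero, so `n` is positive). -/
def IsIrreducibleComplexCharacter {G : Type*} [Group G] (χ : G → ℂ) : Prop :=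
  ∃ (n : ℕ) (ρ : Representation ℂ G (Fin n → ℂ)), ρ.IsIrreducible ∧ ρ.character = χ

/-- A linear character is a character of degree `χ 1 = 1`. -/
def IsLinearCharacter {G : Type*} [Group G] (χ : G → ℂ) : Prop :=
  IsComplexCharacter χ ∧ χ 1 = 1

open Classical in
/-- The induced function `θ^G(g) = |H|⁻¹ ∑_{x ∈ G} θ°(x g x⁻¹)`, where `θ°` is `θ` on `H` and
vanishes outside `H`. -/
def inducedCharacter {G : Type*} [Group G] [Fintype G] (H : Subgroup G) (θ : H → ℂ) (g : G) : ℂ :=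
  (Nat.card H : ℂ)⁻¹ * ∑ x : G, if h : x * g * x⁻¹ ∈ H then θ ⟨x * g * x⁻¹, h⟩ else 0

/-- A character is monomial if it is induced from a linear character of some subgroup
(not necessarily proper). -/
def IsMonomialCharacter {G : Type*} [Group G] [Fintype G] (χ : G → ℂ) : Prop :=
  ∃ (H : Subgroup G) (θ : H → ℂ), IsLinearCharacter θ ∧ inducedCharacter H θ = χ

/-- A finite group is an M-group if all its irreducible complex characters are monomial. -/
def IsMGroup (G : Type*) [Group G] [Fintype G] : Prop :=
  ∀ χ : G → ℂ, IsIrreducibleComplexCharacter χ → IsMonomialCharacter χ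

end

/-! Among subgroups containing G' and having a common eigenvector, take a maximal one H, with
eigenvector v and eigencharacter l; G' itself qualifies, being abelian. H is normal since it
contains G'. If t fixes l, it preserves the l-eigenspace and has an eigenvector there, so t ∈ H by
maximality (`exists_self_stabilizing_eigencharacter`). Hence distinct cosets of H give distinct
conjugates of l, and the translates of v are independent; by irreducibility they span. G permutes
their lines, so the trace is induced from l (`character_eq_inducedCharacter`). -/

namespace Representation

section CommonEigenvectors

variable {k G V : Type*} [Field k] [Group G] [AddCommGroup V] [Module k V]
  (ρ : Representation k G V)

/-- The stabilizer of the line spanned by `v`. -/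
def lineStabilizer (v : V) : Subgroup G where
  carrier := {g | ∃ c : k, ρ g v = c • v}
  one_mem' := ⟨1, by simp⟩
  mul_mem' := by
    rintro a b ⟨c, hc⟩ ⟨d, hd⟩
    exact ⟨d * c, by simp [hc, hd, mul_smul]⟩
  inv_mem' := by
    rintro a ⟨c, hc⟩
    have h : v = c • ρ a⁻¹ v := by
      rw [← map_smul, ← hc, ← Module.End.mul_apply, ← map_mul]
      simp
    by_cases h0 : c = 0
    · have hv : v = 0 := by simpa [h0] using h
      exact ⟨0, by simp [hv]⟩
    · refine ⟨c⁻¹, ?_⟩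
      conv_rhs => rw [h]
      rw [smul_smul, inv_mul_cancel₀ h0, one_smul]

variable {ρ}

lemma mem_lineStabilizer {v : V} {g : G} :
    g ∈ ρ.lineStabilizer v ↔ ∃ c : k, ρ g v = c • v := Iff.rfl

/-- A common eigenvector for a subgroup `H` determines a multiplicative character of `H`. -/
lemma exists_monoidHom_of_le_lineStabilizer {v : V} (hv : v ≠ 0) {H : Subgroup G}
    (hH : H ≤ ρ.lineStabilizer v) : ∃ l : H →* k, ∀ h : H, ρ h v = l h • v := by
  choose l hl using fun h : H => mem_lineStabilizer.1 (hH h.2)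
  refine ⟨⟨⟨l, ?_⟩, ?_⟩, hl⟩
  · apply smul_left_injective k hv
    simp [← hl]
  · intro a b
    apply smul_left_injective k hv
    change l (a * b) • v = (l a * l b) • v
    rw [← hl, Subgroup.coe_mul, map_mul, Module.End.mul_apply, hl b, map_smul, hl a, smul_smul,
      mul_comm]

/-- If `t` fixes a multiplicative character of `H` occurring in a representation, then some vector
is an eigenvector for both `H` and `t`. -/
lemma exists_eigenvector_of_conj_eq [IsAlgClosed k] [FiniteDimensional k V] {v : V} (hv : v ≠ 0)
    {H : Subgroup G} (l : H →* k) (hl : ∀ h : H, ρ h v = l h • v) (t : G)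
    (ht : ∀ h : H, ∃ h' : H, (h' : G) = t⁻¹ * h * t ∧ l h' = l h) :
    ∃ w : V, w ≠ 0 ∧ H ≤ ρ.lineStabilizer w ∧ t ∈ ρ.lineStabilizer w := by
  let W : Submodule k V := ⨅ h : H, Module.End.eigenspace (ρ h) (l h)
  have memW : ∀ w, w ∈ W ↔ ∀ h : H, ρ h w = l h • w := fun w => by simp [W]
  have hW : ∀ w ∈ W, ρ t w ∈ W := by
    intro w hw
    rw [memW] at hw ⊢
    intro h
    obtain ⟨h', e, e'⟩ := ht h
    have e2 : (h : G) * t = t * h' := by rw [e]; group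
    rw [← Module.End.mul_apply, ← map_mul, e2, map_mul, Module.End.mul_apply, hw, map_smul, e']
  have : Nontrivial W := ⟨⟨v, (memW v).2 hl⟩, 0, fun h => hv (congrArg Subtype.val h)⟩
  obtain ⟨c, hc⟩ := Module.End.exists_eigenvalue ((ρ t).restrict hW)
  obtain ⟨w, hw⟩ := hc.exists_hasEigenvector
  refine ⟨w, fun h => hw.2 (Subtype.ext h), fun h hh => ⟨l ⟨h, hh⟩, (memW w).1 w.2 ⟨h, hh⟩⟩, c, ?_⟩
  exact congrArg Subtype.val hw.apply_eq_smul

/-- A commutative finite subgroup has a common eigenvector. -/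
lemma exists_le_lineStabilizer_of_commute [IsAlgClosed k] [FiniteDimensional k V] [Nontrivial V]
    [Finite G] (A : Subgroup G) (hA : ∀ a ∈ A, ∀ b ∈ A, a * b = b * a) :
    ∃ v : V, v ≠ 0 ∧ A ≤ ρ.lineStabilizer v := by
  let P : Set (Subgroup G) := {H | H ≤ A ∧ ∃ v : V, v ≠ 0 ∧ H ≤ ρ.lineStabilizer v}
  obtain ⟨v₀, hv₀⟩ := exists_ne (0 : V)
  have hP : P.Nonempty := ⟨⊥, bot_le, v₀, hv₀, bot_le⟩
  obtain ⟨H, hH⟩ := P.toFinite.exists_maximal hP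
  obtain ⟨hHA, v, hv, hHv⟩ := hH.1
  obtain ⟨l, hl⟩ := exists_monoidHom_of_le_lineStabilizer hv hHv
  refine ⟨v, hv, le_trans (fun t ht => ?_) hHv⟩
  obtain ⟨w, hw, hHw, htw⟩ := exists_eigenvector_of_conj_eq hv l hl t fun h =>
    ⟨h, by rw [mul_assoc, hA _ (hHA h.2) _ ht, inv_mul_cancel_left], rfl⟩
  -- Intersecting with A keeps the competitor to the maximal H inside A.
  exact hH.2 (y := A ⊓ ρ.lineStabilizer w) ⟨inf_le_left, w, hw, inf_le_right⟩
    (le_inf hHA hHw) ⟨ht, htw⟩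

/-- In a finite group with commutative derived subgroup, every nonzero representation contains
an eigenvector of a subgroup `H` containing the derived subgroup, such that the stabilizer of the
eigencharacter is `H` itself. -/
lemma exists_self_stabilizing_eigencharacter [IsAlgClosed k] [FiniteDimensional k V] [Nontrivial V]
    [Finite G] (hG : IsMetabelianGroup G) :
    ∃ (H : Subgroup G) (l : H →* k) (v : V), commutator G ≤ H ∧ v ≠ 0 ∧
      (∀ h : H, ρ h v = l h • v) ∧
      ∀ t : G, (∀ h : H, ∃ h' : H, (h' : G) = t⁻¹ * h * t ∧ l h' = l h) → t ∈ H := by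
  let P : Set (Subgroup G) := {H | commutator G ≤ H ∧ ∃ v : V, v ≠ 0 ∧ H ≤ ρ.lineStabilizer v}
  have hP : P.Nonempty :=
    ⟨commutator G, le_rfl, exists_le_lineStabilizer_of_commute _ hG⟩
  obtain ⟨H, hH⟩ := P.toFinite.exists_maximal hP
  obtain ⟨hGH, v, hv, hHv⟩ := hH.1
  obtain ⟨l, hl⟩ := exists_monoidHom_of_le_lineStabilizer hv hHv
  refine ⟨H, l, v, hGH, hv, hl, fun t ht => ?_⟩
  obtain ⟨w, hw, hHw, htw⟩ := exists_eigenvector_of_conj_eq hv l hl t ht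
  exact hH.2 (y := ρ.lineStabilizer w) ⟨hGH.trans hHw, w, hw, le_rfl⟩ hHw htw

end CommonEigenvectors

section Translates

variable {k G V : Type*} [Field k] [Group G] [AddCommGroup V] [Module k V]
  {ρ : Representation k G V} {H : Subgroup G} {l : H →* k} {v : V}

lemma apply_mul_mem (hl : ∀ h : H, ρ h v = l h • v) (x : G) (h : H) :
    ρ (x * h) v = l h • ρ x v := by
  rw [map_mul, Module.End.mul_apply, hl, map_smul]

/-- Translates of an eigenvector of a normal subgroup by coset representatives are linearly
independent when the stabilizer of the eigencharacter is the subgroup itself. -/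
lemma linearIndependent_translates [H.Normal] (hv : v ≠ 0) (hl : ∀ h : H, ρ h v = l h • v)
    (hst : ∀ t : G, (∀ h : H, ∃ h' : H, (h' : G) = t⁻¹ * h * t ∧ l h' = l h) → t ∈ H) :
    LinearIndependent k (fun q : G ⧸ H => ρ q.out v) := by
  -- The conjugate h ↦ l (x⁻¹hx), by which H acts on `ρ x v`.
  let c (x : G) : H →* k := l.comp (MulAut.conjNormal x⁻¹).toMonoidHom
  have hc : ∀ x (h : H), ρ h (ρ x v) = c x h • ρ x v := by
    intro x h
    rw [← Module.End.mul_apply, ← map_mul]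
    have : (h : G) * x = x * (MulAut.conjNormal x⁻¹ h : H) := by
      simp [mul_assoc]
    rw [this, apply_mul_mem hl]
    rfl
  have hinj : Function.Injective fun q : G ⧸ H => c q.out := by
    intro p q hpq
    rw [← QuotientGroup.out_eq' p, ← QuotientGroup.out_eq' q, QuotientGroup.eq]
    apply hst
    intro h
    let y : H := MulAut.conjNormal p.out h
    refine ⟨MulAut.conjNormal q.out⁻¹ y, by simp [y, mul_assoc], ?_⟩
    have := DFunLike.congr_fun hpq y
    refine (this.symm : c q.out y = c p.out y).trans ?_
    change l (MulAut.conjNormal p.out⁻¹ y) = l h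
    congr 1
    ext
    simp [y]
  -- Dedekind: distinct characters of H are independent.
  have hind := (linearIndependent_monoidHom H k).comp _ hinj
  rw [linearIndependent_iff'] at hind ⊢
  intro s a ha q hq
  have hqv : ρ q.out v ≠ 0 := by
    intro h0
    apply hv
    have := congrArg (ρ q.out⁻¹) h0
    rwa [← Module.End.mul_apply, ← map_mul, inv_mul_cancel, map_one, Module.End.one_apply,
      map_zero] at this
  have key : a q • ρ q.out v = 0 := by
    -- Applying `f ∘ ρ h` to the vector relation gives, as h varies, a scalar relation among the
    -- conjugate characters.
    rw [← Module.forall_dual_apply_eq_zero_iff k]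
    intro f
    have := hind s (fun p => f (a p • ρ p.out v)) ?_ q hq
    · exact this
    · ext h
      have e := congrArg (fun w => f (ρ h w)) ha
      simp only [map_sum, map_smul, hc, map_zero, smul_eq_mul] at e
      simp only [Finset.sum_apply, Pi.smul_apply, Function.comp_apply, smul_eq_mul, map_smul,
        Pi.zero_apply]
      rw [← e]
      exact Finset.sum_congr rfl fun p _ => by ring
  exact (smul_eq_zero.1 key).resolve_right hqv

lemma apply_translate (hl : ∀ h : H, ρ h v = l h • v) (x : G) :
    ∃ a : k, ρ x v = a • ρ (x : G ⧸ H).out v := by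
  have h : (x : G ⧸ H).out⁻¹ * x ∈ H := by
    rw [← QuotientGroup.eq, QuotientGroup.out_eq']
  refine ⟨l ⟨_, h⟩, ?_⟩
  rw [← apply_mul_mem hl]
  simp

/-- Translates of an eigenvector span an irreducible representation. -/
lemma span_translates_eq_top [ρ.IsIrreducible] (hv : v ≠ 0) (hl : ∀ h : H, ρ h v = l h • v) :
    Submodule.span k (Set.range fun q : G ⧸ H => ρ q.out v) = ⊤ := by
  have hmem : ∀ x : G, ρ x v ∈ Submodule.span k (Set.range fun q : G ⧸ H => ρ q.out v) := by
    intro x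
    obtain ⟨a, ha⟩ := apply_translate hl x
    rw [ha]
    exact Submodule.smul_mem _ _ (Submodule.subset_span ⟨_, rfl⟩)
  let S : Subrepresentation ρ := ⟨Submodule.span k (Set.range fun q : G ⧸ H => ρ q.out v), by
    intro g w hw
    induction hw using Submodule.span_induction with
    | mem w hw =>
      obtain ⟨q, rfl⟩ := hw
      rw [← Module.End.mul_apply, ← map_mul]
      exact hmem _
    | zero => simp
    | add a b _ _ ha hb => rw [map_add]; exact add_mem ha hb
    | smul a w _ hw => rw [map_smul]; exact Submodule.smul_mem _ _ hw⟩
  rcases eq_bot_or_eq_top S with h | h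
  · refine absurd ?_ hv
    have h1 := hmem 1
    rw [map_one, Module.End.one_apply] at h1
    have h2 : v ∈ S.toSubmodule := h1
    rw [h] at h2
    exact (Submodule.mem_bot k).1 h2
  · exact congrArg Subrepresentation.toSubmodule h

end Translates

/-- The trace of a representation with a basis of translates of an `H`-eigenvector is the
character induced from the eigencharacter. -/
lemma character_eq_inducedCharacter {G V : Type*} [Group G] [Fintype G] [AddCommGroup V]
    [Module ℂ V] {ρ : Representation ℂ G V} {H : Subgroup G} {l : H →* ℂ} {v : V}
    (hl : ∀ h : H, ρ h v = l h • v) (b : Module.Basis (G ⧸ H) ℂ V)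
    (hb : ∀ q, b q = ρ q.out v) : ρ.character = inducedCharacter H l := by
  classical
  ext g
  let F (x : G) : ℂ := if h : x⁻¹ * g * x ∈ H then l ⟨x⁻¹ * g * x, h⟩ else 0
  -- Any representative x of q is allowed, so summing `F` over G counts each diagonal entry |H|
  -- times.
  have hdiag : ∀ (x : G) (q : G ⧸ H), (x : G ⧸ H) = q →
      b.repr (ρ g (b q)) q = F x := by
    rintro x q rfl
    obtain ⟨h, hh⟩ := QuotientGroup.mk_out_eq_mul H x
    have hlh : l h ≠ 0 := by
      intro h0
      have : l (h * h⁻¹) = 0 := by rw [map_mul, h0, zero_mul]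
      simp at this
    have hbx : b (x : G ⧸ H) = l h • ρ x v := by rw [hb, hh, apply_mul_mem hl]
    simp only [F]
    split_ifs with hx
    · have : g * x = x * (⟨x⁻¹ * g * x, hx⟩ : H) := by simp [mul_assoc]
      have e : ρ g (b (x : G ⧸ H)) = l ⟨x⁻¹ * g * x, hx⟩ • b (x : G ⧸ H) := by
        rw [hbx, map_smul, ← Module.End.mul_apply, ← map_mul, this, apply_mul_mem hl, smul_comm]
      rw [e]
      simp
    -- Here gx lies outside xH, so g moves this basis line to a different one.
    · obtain ⟨a, ha⟩ := apply_translate hl (g * x)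
      rw [hbx, map_smul, ← Module.End.mul_apply, ← map_mul, ha, ← hb]
      have hne : ((g * x : G) : G ⧸ H) ≠ (x : G ⧸ H) := by
        intro e
        apply hx
        rw [mul_assoc]
        exact QuotientGroup.eq.1 e.symm
      simp [Finsupp.single_eq_of_ne hne.symm]
  have hcard : (Nat.card H : ℂ) ≠ 0 := Nat.cast_ne_zero.2 Nat.card_pos.ne'
  have htr : ρ.character g = ∑ q, b.repr (ρ g (b q)) q := by
    rw [character, LinearMap.trace_eq_matrix_trace ℂ b, Matrix.trace]
    exact Finset.sum_congr rfl fun q _ => by simp [LinearMap.toMatrix_apply]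
  have hsum : ∑ x : G, F x = Nat.card H * ρ.character g := by
    rw [htr, ← (Subgroup.groupEquivQuotientProdSubgroup (s := H)).symm.sum_comp,
      Fintype.sum_prod_type, Finset.mul_sum]
    refine Finset.sum_congr rfl fun q _ => ?_
    rw [Finset.sum_congr rfl fun h _ => (hdiag _ q ?_).symm]
    · simp [Nat.card_eq_fintype_card]
    · exact congrArg Prod.fst
        ((Subgroup.groupEquivQuotientProdSubgroup (s := H)).apply_symm_apply (q, h))
  rw [inducedCharacter, eq_inv_mul_iff_mul_eq₀ hcard, ← hsum, ← Equiv.sum_comp (Equiv.inv G) F]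
  refine Finset.sum_congr rfl fun x _ => ?_
  simp only [F, Equiv.inv_apply, inv_inv]

end Representation

/-- A multiplicative map to `ℂ` is a linear character. -/
lemma MonoidHom.isLinearCharacter {H : Type*} [Group H] (l : H →* ℂ) : IsLinearCharacter l := by
  refine ⟨⟨1, (algebraMap ℂ (Module.End ℂ (Fin 1 → ℂ)) : ℂ →* _).comp l, one_pos, ?_⟩, map_one l⟩
  ext h
  simp [Representation.character, Algebra.algebraMap_eq_smul_one]

theorem corollary2p7 (G : Type*) [Group G] [Fintype G] (hG : IsMetabelianGroup G) :
    IsMGroup G := by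
  rintro χ ⟨n, ρ, hρ, rfl⟩
  -- Irreducibility excludes n = 0.
  have : Nontrivial (Fin n → ℂ) := by
    by_contra h
    rw [not_nontrivial_iff_subsingleton] at h
    exact bot_ne_top (α := Subrepresentation ρ)
      (Subrepresentation.toSubmodule_injective (Subsingleton.elim _ _))
  obtain ⟨H, l, v, hGH, hv, hl, hst⟩ :=
    Representation.exists_self_stabilizing_eigencharacter (ρ := ρ) hG
  have : H.Normal := .of_commutator_le _ hGH
  let b := Module.Basis.mk (Representation.linearIndependent_translates hv hl hst)
    (Representation.span_translates_eq_top hv hl).ge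
  exact ⟨H, l, l.isLinearCharacter,
    (Representation.character_eq_inducedCharacter hl b fun q => by simp [b]).symm⟩
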